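/- Let $(W,S)$ be a finite Coxeter system with $S\neq\varnothing$, with length function $\ell$ and longest element $w_0$. For $I\subseteq S$ let $X_I=\{w\in W : \ell(ws)>\ell(w)\text{ for all } s\in I\}$ and $x_I=\sum_{w\in X_I}w\in\mathbb{Q}W$. Let $\Sigma(W)=\sum_{I\subseteq S}\mathbb{Q}\,x_I$; this is a unital subalgebra of the group algebra $\mathbb{Q}W$ (Solomon's theorem), called the descent algebra of $W$. Let $\sigma_0$ be the automorphism $w\mapsto w_0ww_0^{-1}$ of $W$, extended linearly to $\mathbb{Q}W$, and let $\Sigma(W)^{\sigma_0}$ be the subalgebra of the elements of $\Sigma(W)$ fixed by $\sigma_0$. The Loewy length of a finite-dimensional algebra $A$ is the smallest integer $k\ge 1$ such that $(\operatorname{Rad}A)^k=0$, where $\operatorname{Rad}A$ is the Jacobson radical of $A$. Let $\mathrm{LL}(W)$ and $\mathrm{LL}(W,\sigma_0)$ be the Loewy lengths of $\Sigma(W)$ and of $\Sigma(W)^{\sigma_0}$, respectively. Then: (a) $\mathrm{LL}(W)\le |S|$; (b) $\mathrm{LL}(W,\sigma_0)\le \dfrac{|S|+1}{2}$. -/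

import Mathlib

/-- The Loewy length of a ring `R`: the least natural number `k ≥ 1` such that `(Rad R) ^ k = 0`,
where `Rad R` is the Jacobson radical. (For Artinian `R`, in particular for a finite dimensional
algebra, such a `k` exists, see `loewyLength_spec`.) -/
noncomputable def loewyLength (R : Type*) [Ring R] : ℕ :=
  sInf {k : ℕ | 1 ≤ k ∧ Ring.jacobson R ^ k = ⊥}

theorem loewyLength_spec (R : Type*) [Ring R] [IsArtinianRing R] :
    1 ≤ loewyLength R ∧ Ring.jacobson R ^ loewyLength R = ⊥ := by
  have hne : {k : ℕ | 1 ≤ k ∧ Ring.jacobson R ^ k = ⊥}.Nonempty := by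
    obtain ⟨n, hn⟩ := IsSemiprimaryRing.isNilpotent (R := R)
    refine ⟨n + 1, Nat.le_add_left 1 n, ?_⟩
    rw [Submodule.pow_succ, hn]
    simp
  exact Nat.sInf_mem hne

namespace CoxeterSystem

variable {B W : Type*} [Group W] {M : CoxeterMatrix B}

/-- `X_I = {w ∈ W | ws > w for all s ∈ I}`. Here `ws > w` in the Bruhat order amounts to
`ℓ(ws) > ℓ(w)`, because `s` is a reflection. -/
def cosetReps (cs : CoxeterSystem M W) (I : Finset B) : Set W :=
  {w | ∀ i ∈ I, cs.length w < cs.length (w * cs.simple i)}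

open Classical in
/-- `x_I = ∑_{w ∈ X_I} w` in the group algebra `ℚ W`. -/
noncomputable def cosetSum [Fintype W] (cs : CoxeterSystem M W) (I : Finset B) :
    MonoidAlgebra ℚ W :=
  ∑ w ∈ Finset.univ.filter (fun w => w ∈ cs.cosetReps I), MonoidAlgebra.single w 1

/-- The subspace `∑_{I ⊆ S} ℚ x_I` of `ℚ W`. -/
noncomputable def descentSpan [Fintype W] (cs : CoxeterSystem M W) :
    Submodule ℚ (MonoidAlgebra ℚ W) :=
  Submodule.span ℚ (Set.range cs.cosetSum)

/-- The descent algebra `Σ(W)`, as the subalgebra of `ℚ W` generated by the `x_I`. That its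
underlying subspace is exactly `∑_I ℚ x_I` is Solomon's theorem; it is not built in here. -/
noncomputable def descentAlgebra [Fintype W] (cs : CoxeterSystem M W) :
    Subalgebra ℚ (MonoidAlgebra ℚ W) :=
  Algebra.adjoin ℚ (Set.range cs.cosetSum)

/-- `Σ(W)^σ`: the elements of `Σ(W)` fixed by the algebra automorphism of `ℚ W` induced
by an automorphism `σ` of `W`. -/
noncomputable def fixedDescentAlgebra [Fintype W] (cs : CoxeterSystem M W) (σ : W ≃* W) :
    Subalgebra ℚ (MonoidAlgebra ℚ W) :=
  cs.descentAlgebra ⊓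
    AlgHom.equalizer (MonoidAlgebra.mapDomainAlgHom ℚ ℚ (σ : W →* W)) (AlgHom.id ℚ _)

theorem isArtinianRing_fixedDescentAlgebra [Fintype W] (cs : CoxeterSystem M W) (σ : W ≃* W) :
    IsArtinianRing (cs.fixedDescentAlgebra σ) :=
  IsArtinianRing.of_finite ℚ _

theorem isArtinianRing_descentAlgebra [Fintype W] (cs : CoxeterSystem M W) :
    IsArtinianRing cs.descentAlgebra :=
  IsArtinianRing.of_finite ℚ _

/-- `w₀` is a longest element of `W`. -/
def IsLongest (cs : CoxeterSystem M W) (w₀ : W) : Prop :=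
  ∀ w : W, cs.length w ≤ cs.length w₀

end CoxeterSystem

/-! Let `n = |S|` and let `F_k` (`cardSpan`) be spanned by the `x_K` with `|K| < k`. Solomon's rule
(`cosetSum_mul_cosetSum`) writes `x_I x_J` as a sum of `x_K` with `K ⊆ J`. So `F_k` is stable under
left multiplication by the descent algebra, and every element acts on `x_J` as a scalar modulo
`F_|J|`. For a nilpotent element that scalar contributes nothing modulo `F_|J|`, so nilpotents map
`F_(k+1)` into `F_k`. Since `1 = x_S` lies in `F_(n+1)`, the `n`-th power of the radical lies in
`F_1 = ℚ x_∅`. As `x_∅ ^ 2 = |W| x_∅`, this line has no nonzero nilpotent, which gives (a).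

For (b), `w₀` reverses descents, so `w₀ x_J = ∑ (-1)^|K| x_K` over `K ⊆ J`, and `w₀` acts on
`F_(k+1) / F_k` by `(-1)^k`. Elements fixed by `σ₀` commute with `w₀` and preserve its eigenspaces.
A nilpotent one lowers an eigenvector of the top sign by one layer; the sign is wrong there, so it
drops by a second. Splitting `1` into `w₀`-eigenvectors then halves the bound.

Solomon's rule rests on the cocycle identity for inversions, which also yields the exchange
condition. -/

namespace CoxeterSystem

/-! ### Inversion cocycle and strong exchange -/

variable {B W : Type*} [Group W] {M : CoxeterMatrix B} (cs : CoxeterSystem M W)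

open Classical in
/-- The action of a simple reflection on `W × ZMod 2` by conjugation on the first factor, changing
the second factor exactly over the simple reflection itself. -/
noncomputable def signedConj (i : B) : Equiv.Perm (W × ZMod 2) :=
  Function.Involutive.toPerm
    (fun p => (cs.simple i * p.1 * cs.simple i, p.2 + if p.1 = cs.simple i then 1 else 0)) <| by
    rintro ⟨t, e⟩
    have h : cs.simple i * t * cs.simple i = cs.simple i ↔ t = cs.simple i := by
      constructor
      · intro h
        have := congrArg (fun x => cs.simple i * x * cs.simple i) h
        simpa [mul_assoc] using this
      · rintro rfl
        simp
    ext
    · simp [mul_assoc]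
    · simp only [h]
      split_ifs <;> simp [add_assoc, CharTwo.add_self_eq_zero]

open Classical in
theorem signedConj_apply (i : B) (t : W) (e : ZMod 2) :
    cs.signedConj i (t, e) =
      (cs.simple i * t * cs.simple i, e + if t = cs.simple i then 1 else 0) := rfl

theorem simple_mul_pow_mul_simple (i j : B) (k : ℕ) :
    (cs.simple i * cs.simple j) ^ k * cs.simple j * (cs.simple i * cs.simple j) ^ k =
      cs.simple j := by
  induction k with
  | zero => simp
  | succ k ih =>
    nth_rewrite 2 [pow_succ']
    rw [pow_succ]
    calc _ = (cs.simple i * cs.simple j) ^ k * (cs.simple i * cs.simple j * cs.simple j *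
              (cs.simple i * cs.simple j)) * (cs.simple i * cs.simple j) ^ k := by
            simp only [mul_assoc]
      _ = _ := by simpa [mul_assoc] using ih

open Classical in
theorem signedConj_mul_pow_apply (i j : B) (k : ℕ) (t : W) (e : ZMod 2) :
    ((cs.signedConj i * cs.signedConj j) ^ k) (t, e) =
      ((cs.simple i * cs.simple j) ^ k * t * ((cs.simple i * cs.simple j) ^ k)⁻¹,
        e + ∑ l ∈ Finset.range (2 * k),
          if t = cs.simple j * (cs.simple i * cs.simple j) ^ l then 1 else 0) := by
  induction k with
  | zero => simp
  | succ k ih =>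
    set c := cs.simple i * cs.simple j with hc
    have hck : (c ^ k)⁻¹ * cs.simple j = cs.simple j * c ^ k := by
      rw [inv_mul_eq_iff_eq_mul, ← mul_assoc]
      exact (cs.simple_mul_pow_mul_simple i j k).symm
    have conj_iff (x : W) : c ^ k * t * (c ^ k)⁻¹ = x ↔ t = (c ^ k)⁻¹ * x * c ^ k := by
      rw [mul_inv_eq_iff_eq_mul, mul_assoc (c ^ k)⁻¹, eq_inv_mul_iff_mul_eq]
    have e1 : (c ^ k * t * (c ^ k)⁻¹ = cs.simple j) ↔ t = cs.simple j * c ^ (2 * k) := by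
      rw [conj_iff, hck, two_mul, pow_add, mul_assoc]
    have e2 : (cs.simple j * (c ^ k * t * (c ^ k)⁻¹) * cs.simple j = cs.simple i) ↔
        t = cs.simple j * c ^ (2 * k + 1) := by
      have : cs.simple j * (c ^ k * t * (c ^ k)⁻¹) * cs.simple j = cs.simple i ↔
          c ^ k * t * (c ^ k)⁻¹ = cs.simple j * c := by
        constructor
        · intro h
          have := congrArg (fun x => cs.simple j * x * cs.simple j) h
          simpa [mul_assoc, hc] using this
        · intro h
          rw [h, hc]
          simp [mul_assoc]
      rw [this, conj_iff, ← mul_assoc, hck, two_mul, add_assoc, pow_add, pow_succ']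
      simp only [mul_assoc]
    rw [pow_succ', Equiv.Perm.mul_apply, ih, Equiv.Perm.mul_apply, signedConj_apply,
      signedConj_apply]
    ext
    · simp [hc, pow_succ', mul_assoc]
    · simp only [e1, e2]
      rw [show 2 * (k + 1) = 2 * k + 1 + 1 by ring, Finset.sum_range_succ, Finset.sum_range_succ]
      ring

/-- For `k = M i j` the `2k` parity terms run twice through a period of `s_i s_j`, so they cancel
modulo 2. -/
theorem isLiftable_signedConj : M.IsLiftable cs.signedConj := by
  classical
  intro i j
  ext1 ⟨t, e⟩
  rw [signedConj_mul_pow_apply, two_mul, Finset.sum_range_add]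
  simp [pow_add, cs.simple_mul_simple_pow, CharTwo.add_self_eq_zero]

/-- The action of `W` on `W × ZMod 2` that extends `signedConj`. -/
noncomputable def signedConjHom : W →* Equiv.Perm (W × ZMod 2) :=
  cs.lift ⟨cs.signedConj, cs.isLiftable_signedConj⟩

theorem signedConjHom_simple (i : B) : cs.signedConjHom (cs.simple i) = cs.signedConj i :=
  cs.lift_apply_simple cs.isLiftable_signedConj i

open Classical in
theorem signedConjHom_wordProd (ω : List B) (t : W) (e : ZMod 2) :
    cs.signedConjHom (cs.wordProd ω) (t, e) =
      (cs.wordProd ω * t * (cs.wordProd ω)⁻¹, e + ((cs.rightInvSeq ω).count t : ℕ)) := by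
  induction ω with
  | nil => simp
  | cons i ω ih =>
    have h : cs.wordProd ω * t * (cs.wordProd ω)⁻¹ = cs.simple i ↔
        (cs.wordProd ω)⁻¹ * cs.simple i * cs.wordProd ω = t := by
      rw [mul_inv_eq_iff_eq_mul, mul_assoc, inv_mul_eq_iff_eq_mul, eq_comm]
    rw [wordProd_cons, map_mul, Equiv.Perm.mul_apply, ih, signedConjHom_simple, signedConj_apply]
    ext
    · simp [mul_assoc]
    · simp only [rightInvSeq, List.count_cons, h, beq_iff_eq]
      push_cast
      ring

/-- The parity of the number of occurrences of `t` in the inversion sequence of a word for `w`. -/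
noncomputable def inversionParity (w t : W) : ZMod 2 := (cs.signedConjHom w (t, 0)).2

open Classical in
theorem inversionParity_wordProd (ω : List B) (t : W) :
    cs.inversionParity (cs.wordProd ω) t = ((cs.rightInvSeq ω).count t : ℕ) := by
  simp [inversionParity, signedConjHom_wordProd]

theorem signedConjHom_apply (w t : W) (e : ZMod 2) :
    cs.signedConjHom w (t, e) = (w * t * w⁻¹, e + cs.inversionParity w t) := by
  obtain ⟨ω, rfl⟩ := cs.wordProd_surjective w
  simp [inversionParity, signedConjHom_wordProd]

theorem inversionParity_mul (w v t : W) :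
    cs.inversionParity (w * v) t =
      cs.inversionParity v t + cs.inversionParity w (v * t * v⁻¹) := by
  rw [inversionParity, map_mul, Equiv.Perm.mul_apply, signedConjHom_apply, signedConjHom_apply]
  simp

theorem inversionParity_one (t : W) : cs.inversionParity 1 t = 0 := by
  simp [inversionParity]

variable {cs} in
theorem IsReflection.inversionParity_self {t : W} (ht : cs.IsReflection t) :
    cs.inversionParity t t = 1 := by
  obtain ⟨u, i, rfl⟩ := ht
  have h := cs.inversionParity_mul u u⁻¹ (u * cs.simple i * u⁻¹)
  have hs : cs.inversionParity (cs.simple i) (cs.simple i) = 1 := by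
    rw [inversionParity, signedConjHom_simple, signedConj_apply]
    simp
  have e : u⁻¹ * (u * cs.simple i * u⁻¹) * u⁻¹⁻¹ = cs.simple i := by group
  -- From `u * u⁻¹ = 1`, the contributions of `u⁻¹` and `u` cancel, leaving that of the simple
  -- reflection.
  rw [mul_inv_cancel, inversionParity_one, e] at h
  rw [inversionParity_mul, inversionParity_mul, e, hs, mul_inv_cancel_right]
  linear_combination -h

theorem mem_rightInvSeq_of_inversionParity_ne_zero {ω : List B} {t : W}
    (h : cs.inversionParity (cs.wordProd ω) t ≠ 0) : t ∈ cs.rightInvSeq ω := by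
  classical
  rw [inversionParity_wordProd] at h
  by_contra hn
  exact h (by simp [List.count_eq_zero_of_not_mem hn])

variable {cs} in
theorem IsReflection.isRightInversion_iff {t : W} (ht : cs.IsReflection t) (w : W) :
    cs.IsRightInversion w t ↔ cs.inversionParity w t = 1 := by
  have key : ∀ v : W, cs.inversionParity v t = 1 → cs.IsRightInversion v t := by
    intro v hv
    obtain ⟨ω, hω, rfl⟩ := cs.exists_isReduced v
    exact cs.isRightInversion_of_mem_rightInvSeq hω
      (cs.mem_rightInvSeq_of_inversionParity_ne_zero (by simp [hv]))
  refine ⟨fun h => ?_, key w⟩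
  -- If the parity at `w` were 0, it would be 1 at `w * t`, making `t` an inversion of `w * t` and
  -- hence not of `w`.
  by_contra hn
  rw [← ht.not_isRightInversion_mul_left_iff] at h
  refine h (key _ ?_)
  rw [inversionParity_mul, ht.inversionParity_self, mul_inv_cancel_right]
  generalize cs.inversionParity w t = x at *
  fin_cases x
  · rfl
  · exact absurd rfl hn

/-- The cocycle identity for right inversions. -/
theorem isRightInversion_mul_iff (w v : W) {t : W} (ht : cs.IsReflection t) :
    cs.IsRightInversion (w * v) t ↔
      ¬ (cs.IsRightInversion v t ↔ cs.IsRightInversion w (v * t * v⁻¹)) := by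
  rw [ht.isRightInversion_iff, ht.isRightInversion_iff, (ht.conj v).isRightInversion_iff,
    inversionParity_mul]
  generalize cs.inversionParity v t = x
  generalize cs.inversionParity w (v * t * v⁻¹) = y
  revert x y
  decide

/-- The strong exchange condition. -/
theorem mem_rightInvSeq_of_isRightInversion {ω : List B} {t : W}
    (h : cs.IsRightInversion (cs.wordProd ω) t) : t ∈ cs.rightInvSeq ω :=
  cs.mem_rightInvSeq_of_inversionParity_ne_zero (by simp [(h.1.isRightInversion_iff _).1 h])

end CoxeterSystem

/-! ### Parabolic cosets and Solomon's multiplication rule -/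

namespace CoxeterSystem

variable {B W : Type*} [Group W] {M : CoxeterMatrix B} (cs : CoxeterSystem M W)

/-- The standard parabolic subgroup generated by the simple reflections in `I`. -/
def parabolic (I : Finset B) : Subgroup W := Subgroup.closure (cs.simple '' (I : Set B))

variable {cs} {I J : Finset B}

theorem simple_mem_parabolic {i : B} (hi : i ∈ I) : cs.simple i ∈ cs.parabolic I :=
  Subgroup.subset_closure ⟨i, hi, rfl⟩

theorem exists_wordProd_of_mem_parabolic {y : W} (hy : y ∈ cs.parabolic I) :
    ∃ ω : List B, (∀ i ∈ ω, i ∈ I) ∧ cs.wordProd ω = y := by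
  induction hy using Subgroup.closure_induction with
  | mem x hx =>
    obtain ⟨i, hi, rfl⟩ := hx
    exact ⟨[i], by simpa using hi, by simp⟩
  | one => exact ⟨[], by simp, by simp⟩
  | mul x y _ _ hx hy =>
    obtain ⟨ω, hω, rfl⟩ := hx
    obtain ⟨ω', hω', rfl⟩ := hy
    refine ⟨ω ++ ω', fun i hi => ?_, cs.wordProd_append _ _⟩
    rcases List.mem_append.1 hi with h | h
    exacts [hω i h, hω' i h]
  | inv x _ hx =>
    obtain ⟨ω, hω, rfl⟩ := hx
    exact ⟨ω.reverse, fun i hi => hω i (List.mem_reverse.1 hi), cs.wordProd_reverse _⟩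

theorem wordProd_mem_parabolic {ω : List B} (hω : ∀ i ∈ ω, i ∈ I) :
    cs.wordProd ω ∈ cs.parabolic I := by
  induction ω with
  | nil => simp [one_mem]
  | cons i ω ih =>
    rw [wordProd_cons]
    exact mul_mem (simple_mem_parabolic (hω i List.mem_cons_self))
      (ih fun j hj => hω j (List.mem_cons_of_mem _ hj))

theorem mem_parabolic_of_mem_rightInvSeq {ω : List B} (hω : ∀ i ∈ ω, i ∈ I) {t : W}
    (ht : t ∈ cs.rightInvSeq ω) : t ∈ cs.parabolic I := by
  induction ω with
  | nil => simp at ht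
  | cons i ω ih =>
    have hω' : ∀ j ∈ ω, j ∈ I := fun j hj => hω j (List.mem_cons_of_mem _ hj)
    rw [rightInvSeq, List.mem_cons] at ht
    rcases ht with rfl | ht
    · exact mul_mem (mul_mem (inv_mem (wordProd_mem_parabolic hω'))
        (simple_mem_parabolic (hω i List.mem_cons_self))) (wordProd_mem_parabolic hω')
    · exact ih hω' ht

theorem IsRightInversion.mem_parabolic {y t : W} (h : cs.IsRightInversion y t)
    (hy : y ∈ cs.parabolic I) : t ∈ cs.parabolic I := by
  obtain ⟨ω, hω, rfl⟩ := exists_wordProd_of_mem_parabolic hy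
  exact mem_parabolic_of_mem_rightInvSeq hω (cs.mem_rightInvSeq_of_isRightInversion h)

theorem exists_isRightDescent_of_mem_parabolic {y : W} (hy : y ∈ cs.parabolic I) (h1 : y ≠ 1) :
    ∃ i ∈ I, cs.IsRightDescent y i := by
  obtain ⟨ω, ⟨hω, rfl⟩, hmin⟩ := WellFounded.has_min (measure List.length).wf
    {ω : List B | (∀ i ∈ ω, i ∈ I) ∧ cs.wordProd ω = y} (exists_wordProd_of_mem_parabolic hy)
  rcases List.eq_nil_or_concat ω with rfl | ⟨ω', i, rfl⟩
  · simp at h1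
  have hω' : ∀ j ∈ ω', j ∈ I := fun j hj => hω j (by simp [hj])
  refine ⟨i, hω i (by simp), ?_⟩
  -- Minimality is among words in `I` only. If the last letter were not a descent, exchange would
  -- delete a letter of `ω'` and give a shorter word in `I` for the same element.
  by_contra hn
  have h : cs.IsRightInversion (cs.wordProd ω') (cs.simple i) := by
    rw [← cs.isRightInversion_simple_iff_isRightDescent, wordProd_concat,
      (cs.isReflection_simple i).not_isRightInversion_mul_left_iff] at hn
    exact hn
  obtain ⟨j, hj, hji⟩ := List.mem_iff_getElem.1 (cs.mem_rightInvSeq_of_isRightInversion h)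
  refine hmin (ω'.eraseIdx j) ⟨fun k hk => hω' k (List.mem_of_mem_eraseIdx hk), ?_⟩ ?_
  · rw [← cs.wordProd_mul_getD_rightInvSeq, List.getD_eq_getElem _ _ hj, hji, wordProd_concat]
  · change (ω'.eraseIdx j).length < (ω'.concat i).length
    have := List.length_eraseIdx_le ω' j
    simp only [List.concat_eq_append, List.length_append, List.length_singleton]
    omega

theorem mem_cosetReps_iff {w : W} : w ∈ cs.cosetReps I ↔ ∀ i ∈ I, ¬ cs.IsRightDescent w i := by
  refine forall₂_congr fun i _ => ?_
  rw [IsRightDescent, not_lt]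
  exact ⟨le_of_lt, fun h => lt_of_le_of_ne h (cs.length_mul_simple_ne w i).symm⟩

theorem eq_one_of_mem_cosetReps_of_mem_parabolic {y : W} (h : y ∈ cs.cosetReps I)
    (hy : y ∈ cs.parabolic I) : y = 1 := by
  by_contra h1
  obtain ⟨i, hi, hd⟩ := exists_isRightDescent_of_mem_parabolic hy h1
  exact mem_cosetReps_iff.1 h i hi hd

theorem exists_minimal_mul_mem_parabolic (cs : CoxeterSystem M W) (I : Finset B) (w : W) :
    ∃ u, (∀ y ∈ cs.parabolic I, cs.length u ≤ cs.length (u * y)) ∧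
      ∃ y ∈ cs.parabolic I, u * y = w := by
  obtain ⟨u, ⟨y, hy, rfl⟩, hmin⟩ := WellFounded.has_min (measure cs.length).wf
    {u : W | ∃ y ∈ cs.parabolic I, u * y = w} ⟨w, 1, one_mem _, mul_one w⟩
  refine ⟨u, fun z hz => not_lt.1 (hmin (u * z) ⟨z⁻¹ * y, mul_mem (inv_mem hz) hy, ?_⟩),
    y, hy, rfl⟩
  group

/-- Local minimality implies global minimality: write `u = v * z` with `v` shortest in the coset. As
`v` has no inversion in the parabolic subgroup, `z` inherits the absence of descents in `I`, so `z =
1`. -/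
theorem minimal_of_mem_cosetReps {u : W} (hu : u ∈ cs.cosetReps I) {y : W}
    (hy : y ∈ cs.parabolic I) : cs.length u ≤ cs.length (u * y) := by
  obtain ⟨v, hv, z, hz, rfl⟩ := exists_minimal_mul_mem_parabolic cs I u
  have : z ∈ cs.cosetReps I := by
    refine mem_cosetReps_iff.2 fun i hi hd => mem_cosetReps_iff.1 hu i hi ?_
    rw [← isRightInversion_simple_iff_isRightDescent] at hd ⊢
    rw [cs.isRightInversion_mul_iff _ _ (cs.isReflection_simple i)]
    have hm : z * cs.simple i * z⁻¹ ∈ cs.parabolic I :=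
      mul_mem (mul_mem hz (simple_mem_parabolic hi)) (inv_mem hz)
    have : ¬ cs.IsRightInversion v (z * cs.simple i * z⁻¹) := fun h => (hv _ hm).not_gt h.2
    tauto
  obtain rfl := eq_one_of_mem_cosetReps_of_mem_parabolic this hz
  rw [mul_one]
  exact hv y hy

theorem not_isRightInversion_of_mem_cosetReps {u t : W} (hu : u ∈ cs.cosetReps I)
    (ht : t ∈ cs.parabolic I) : ¬ cs.IsRightInversion u t :=
  fun h => (minimal_of_mem_cosetReps hu ht).not_gt h.2

theorem exists_cosetReps_mul_parabolic (cs : CoxeterSystem M W) (I : Finset B) (w : W) :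
    ∃ u ∈ cs.cosetReps I, ∃ y ∈ cs.parabolic I, u * y = w := by
  obtain ⟨u, hu, h⟩ := exists_minimal_mul_mem_parabolic cs I w
  exact ⟨u, mem_cosetReps_iff.2 fun i hi hd => (hu _ (simple_mem_parabolic hi)).not_gt hd, h⟩

theorem isRightInversion_cosetReps_mul_iff {u y t : W} (hu : u ∈ cs.cosetReps I)
    (hy : y ∈ cs.parabolic I) (ht : t ∈ cs.parabolic I) :
    cs.IsRightInversion (u * y) t ↔ cs.IsRightInversion y t := by
  by_cases hr : cs.IsReflection t
  · rw [cs.isRightInversion_mul_iff _ _ hr]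
    have := not_isRightInversion_of_mem_cosetReps hu (mul_mem (mul_mem hy ht) (inv_mem hy))
    tauto
  · exact iff_of_false (fun h => hr h.1) fun h => hr h.1

theorem cosetReps_mul_parabolic_injective {u u' y y' : W} (hu : u ∈ cs.cosetReps I)
    (hu' : u' ∈ cs.cosetReps I) (hy : y ∈ cs.parabolic I) (hy' : y' ∈ cs.parabolic I)
    (h : u * y = u' * y') : u = u' := by
  have hz : y' * y⁻¹ ∈ cs.parabolic I := mul_mem hy' (inv_mem hy)
  have e : u = u' * (y' * y⁻¹) := by rw [← mul_assoc, ← h, mul_inv_cancel_right]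
  have : y' * y⁻¹ ∈ cs.cosetReps I := by
    refine mem_cosetReps_iff.2 fun i hi hd => mem_cosetReps_iff.1 hu i hi ?_
    rw [← isRightInversion_simple_iff_isRightDescent] at hd ⊢
    rw [e]
    exact (isRightInversion_cosetReps_mul_iff hu' hz (simple_mem_parabolic hi)).2 hd
  rw [e, eq_one_of_mem_cosetReps_of_mem_parabolic this hz, mul_one]

/-- A left coset representative `d` for `I` for which `parabolic I * d` meets `cosetReps J`. -/
def IsDoubleCosetRep (cs : CoxeterSystem M W) (I J : Finset B) (d : W) : Prop :=
  d⁻¹ ∈ cs.cosetReps I ∧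
    ∀ j ∈ J, d * cs.simple j * d⁻¹ ∉ cs.parabolic I → ¬ cs.IsRightDescent d j

open Classical in
/-- The elements of `J` that conjugation by `d` moves into `parabolic I`. -/
noncomputable def conjInter (cs : CoxeterSystem M W) (I J : Finset B) (d : W) : Finset B :=
  J.filter fun j => d * cs.simple j * d⁻¹ ∈ cs.parabolic I

/-- By the cocycle identity, if `d` conjugates `s_j` into the parabolic subgroup, then `u` does not
affect the descent at `j`; otherwise `y` does not, since its inversions all lie in that subgroup. -/
theorem mul_mem_cosetReps_iff {u y d : W} (hd : d⁻¹ ∈ cs.cosetReps I) (hu : u ∈ cs.cosetReps I)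
    (hy : y ∈ cs.parabolic I) :
    y * d ∈ cs.cosetReps J ↔
      cs.IsDoubleCosetRep I J d ∧ u * (y * d) ∈ cs.cosetReps (cs.conjInter I J d) := by
  have hin {j : B} (hj : d * cs.simple j * d⁻¹ ∈ cs.parabolic I) :
      cs.IsRightDescent (u * (y * d)) j ↔ cs.IsRightDescent (y * d) j := by
    have hd' : ¬ cs.IsRightInversion d (cs.simple j) := by
      have := not_isRightInversion_of_mem_cosetReps hd hj
      rw [cs.isRightInversion_inv_iff] at this
      refine fun h => this ⟨(cs.isReflection_simple j).conj d, ?_⟩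
      simpa using h.2
    simp only [← isRightInversion_simple_iff_isRightDescent]
    rw [← mul_assoc, cs.isRightInversion_mul_iff _ _ (cs.isReflection_simple j),
      cs.isRightInversion_mul_iff _ _ (cs.isReflection_simple j),
      isRightInversion_cosetReps_mul_iff hu hy hj]
  have hout {j : B} (hj : d * cs.simple j * d⁻¹ ∉ cs.parabolic I) :
      cs.IsRightDescent (y * d) j ↔ cs.IsRightDescent d j := by
    simp only [← isRightInversion_simple_iff_isRightDescent]
    rw [cs.isRightInversion_mul_iff _ _ (cs.isReflection_simple j)]
    have : ¬ cs.IsRightInversion y (d * cs.simple j * d⁻¹) := fun h => hj (h.mem_parabolic hy)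
    tauto
  simp only [IsDoubleCosetRep, mem_cosetReps_iff, conjInter, Finset.mem_filter] at hd ⊢
  constructor
  · intro h
    refine ⟨⟨hd, fun j hj hjI => (hout hjI).not.1 (h j hj)⟩, fun j hj => ?_⟩
    exact (hin hj.2).not.2 (h j hj.1)
  · rintro ⟨⟨-, h1⟩, h2⟩ j hj
    by_cases hjI : d * cs.simple j * d⁻¹ ∈ cs.parabolic I
    · exact (hin hjI).not.1 (h2 j ⟨hj, hjI⟩)
    · exact (hout hjI).not.2 (h1 j hj hjI)

theorem exists_parabolic_mul_cosetReps (cs : CoxeterSystem M W) (I : Finset B) (v : W) :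
    ∃ d : W, d⁻¹ ∈ cs.cosetReps I ∧ v * d⁻¹ ∈ cs.parabolic I := by
  obtain ⟨u, hu, y, hy, h⟩ := exists_cosetReps_mul_parabolic cs I v⁻¹
  refine ⟨u⁻¹, by simpa using hu, ?_⟩
  have : v * u⁻¹⁻¹ = y⁻¹ := by rw [← inv_inv v, ← h]; group
  rw [this]
  exact inv_mem hy

theorem eq_of_mul_inv_mem_parabolic {v d d' : W} (hd : d⁻¹ ∈ cs.cosetReps I)
    (hd' : d'⁻¹ ∈ cs.cosetReps I) (h : v * d⁻¹ ∈ cs.parabolic I)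
    (h' : v * d'⁻¹ ∈ cs.parabolic I) : d = d' := by
  refine inv_injective (cosetReps_mul_parabolic_injective hd hd' (inv_mem h) (inv_mem h') ?_)
  group

open Classical in
/-- Solomon's multiplication rule. -/
theorem cosetSum_mul_cosetSum [Fintype W] (cs : CoxeterSystem M W) (I J : Finset B) :
    cs.cosetSum I * cs.cosetSum J =
      ∑ d ∈ Finset.univ.filter (cs.IsDoubleCosetRep I J), cs.cosetSum (cs.conjInter I J d) := by
  choose d hd hdP using exists_parabolic_mul_cosetReps cs I
  simp only [cosetSum]
  rw [Finset.sum_mul_sum, ← Finset.sum_product', Finset.sum_sigma']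
  -- Factor `v = y * d` and regroup the pairs `(u, v)` by `d`; the inverse map factors `w * d⁻¹` as
  -- `u * y`.
  refine Finset.sum_bij (fun p _ => ⟨d p.2, p.1 * p.2⟩) ?_ ?_ ?_ ?_
  · rintro ⟨u, v⟩ h
    simp only [Finset.mem_product, Finset.mem_filter, Finset.mem_univ, true_and] at h
    simp only [Finset.mem_sigma, Finset.mem_filter, Finset.mem_univ, true_and]
    have := (mul_mem_cosetReps_iff (J := J) (hd v) h.1 (hdP v)).1 (by simpa using h.2)
    simpa using this
  · rintro ⟨u, v⟩ h ⟨u', v'⟩ h' e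
    simp only [Finset.mem_product, Finset.mem_filter, Finset.mem_univ, true_and] at h h'
    simp only [Sigma.mk.injEq, heq_eq_eq] at e
    obtain ⟨e1, e2⟩ := e
    have hu : u = u' := by
      refine cosetReps_mul_parabolic_injective h.1 h'.1 (hdP v) (hdP v') ?_
      rw [← mul_assoc, ← mul_assoc, e1, e2]
    subst hu
    simpa using e2
  · rintro ⟨d', w⟩ h
    simp only [Finset.mem_sigma, Finset.mem_filter, Finset.mem_univ, true_and] at h
    obtain ⟨u, hu, y, hy, e⟩ := exists_cosetReps_mul_parabolic cs I (w * d'⁻¹)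
    have ew : u * (y * d') = w := by rw [← mul_assoc, e, inv_mul_cancel_right]
    have ed : d (y * d') = d' :=
      eq_of_mul_inv_mem_parabolic (hd _) h.1.1 (hdP _) (by simpa using hy)
    refine ⟨(u, y * d'), ?_, ?_⟩
    · simp only [Finset.mem_product, Finset.mem_filter, Finset.mem_univ, true_and]
      exact ⟨hu, (mul_mem_cosetReps_iff h.1.1 hu hy).2 ⟨h.1, by rw [ew]; exact h.2⟩⟩
    · simp [ed, ew]
  · rintro ⟨u, v⟩ -
    simp [MonoidAlgebra.single_mul_single]

end CoxeterSystem

/-! ### Radical powers acting on a filtration -/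

theorem Ring.isNilpotent_of_mem_jacobson {R : Type*} [Ring R] [IsArtinianRing R] {a : R}
    (ha : a ∈ Ring.jacobson R) : IsNilpotent a := by
  obtain ⟨n, hn⟩ := IsSemiprimaryRing.isNilpotent (R := R)
  exact ⟨n, by simpa [hn] using Ideal.pow_mem_pow ha n⟩

/-- If multiplication by elements of the radical lowers a filtration by `e`, then multiplication by
elements of its `m`-th power lowers the filtration by `m * e`. -/
theorem Ring.mul_mem_of_mem_jacobson_pow {E : Type*} [Ring E] [Algebra ℚ E]
    {A : Subalgebra ℚ E} (e : ℕ)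
    (F : ℕ → Submodule ℚ E)
    (hA : ∀ a ∈ A, ∀ k, ∀ v ∈ F k, a * v ∈ F k)
    (hF : ∀ a ∈ Ring.jacobson A, ∀ k, ∀ v ∈ F k, (a : E) * v ∈ F (k - e))
    {m : ℕ} {r : A} (hr : r ∈ Ring.jacobson A ^ m) {k : ℕ} {v : E}
    (hv : v ∈ F k) : (r : E) * v ∈ F (k - m * e) := by
  induction m generalizing r k v with
  | zero => simpa using hA r r.2 k v hv
  | succ m ih =>
    rw [Submodule.pow_succ] at hr
    induction hr using Submodule.mul_induction_on' with
    | mem_mul_mem a ha b hb =>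
      have := ih ha (hF b hb k v hv)
      rwa [Nat.sub_sub, ← mul_assoc, add_comm e, ← Nat.succ_mul] at this
    | add a _ b _ iha ihb =>
      rw [Subalgebra.coe_add, add_mul (a : E)]
      exact add_mem iha ihb

/-! ### The longest element -/

namespace CoxeterSystem

variable {B W : Type*} [Group W] {M : CoxeterMatrix B} {cs : CoxeterSystem M W}

/-- Every reflection is an inversion of `w₀`, so the cocycle identity flips each descent. -/
theorem IsLongest.isRightDescent_mul_iff {w₀ : W} (hw₀ : cs.IsLongest w₀) (w : W) (i : B) :
    cs.IsRightDescent (w₀ * w) i ↔ ¬ cs.IsRightDescent w i := by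
  rw [← isRightInversion_simple_iff_isRightDescent, ← isRightInversion_simple_iff_isRightDescent,
    cs.isRightInversion_mul_iff _ _ (cs.isReflection_simple i)]
  have ht := (cs.isReflection_simple i).conj w
  have : cs.IsRightInversion w₀ (w * cs.simple i * w⁻¹) :=
    ⟨ht, lt_of_le_of_ne (hw₀ _) (ht.length_mul_left_ne w₀)⟩
  tauto

theorem IsLongest.mul_self {w₀ : W} (hw₀ : cs.IsLongest w₀) : w₀ * w₀ = 1 := by
  by_contra h
  obtain ⟨i, hi⟩ := cs.exists_rightDescent_of_ne_one h
  refine (hw₀.isRightDescent_mul_iff w₀ i).1 hi ?_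
  exact lt_of_le_of_ne (hw₀ _) (cs.length_mul_simple_ne w₀ i)

variable [Fintype W]

open Classical in
theorem coeff_cosetSum (I : Finset B) (w : W) :
    (cs.cosetSum I).coeff w = if w ∈ cs.cosetReps I then 1 else 0 := by
  simp [cosetSum, MonoidAlgebra.coeff_sum, Finsupp.single_apply]

/-- Inclusion-exclusion: at `w₀ * v` the right side is the alternating sum over subsets of the
descents of `v` in `J`. -/
theorem IsLongest.single_mul_cosetSum {w₀ : W} (hw₀ : cs.IsLongest w₀) (J : Finset B) :
    MonoidAlgebra.single w₀ 1 * cs.cosetSum J =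
      ∑ K ∈ J.powerset, (-1 : ℚ) ^ K.card • cs.cosetSum K := by
  classical
  ext w
  obtain ⟨v, rfl⟩ : ∃ v, w₀ * v = w := ⟨w₀⁻¹ * w, by group⟩
  have h1 (K : Finset B) : w₀ * v ∈ cs.cosetReps K ↔ ∀ i ∈ K, cs.IsRightDescent v i := by
    simp only [mem_cosetReps_iff, hw₀.isRightDescent_mul_iff, not_not]
  have h2 : v ∈ cs.cosetReps J ↔ J.filter (cs.IsRightDescent v) = ∅ := by
    simp [mem_cosetReps_iff, Finset.filter_eq_empty_iff]
  have h3 : J.powerset.filter (fun K => ∀ i ∈ K, cs.IsRightDescent v i) =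
      (J.filter (cs.IsRightDescent v)).powerset := by
    ext K
    simp only [Finset.mem_filter, Finset.mem_powerset, Finset.subset_iff]
    exact ⟨fun h i hi => ⟨h.1 hi, h.2 i hi⟩, fun h => ⟨fun i hi => (h hi).1, fun i hi => (h hi).2⟩⟩
  have h4 := Finset.sum_powerset_neg_one_pow_card (x := J.filter (cs.IsRightDescent v))
  have h5 : ∑ K ∈ (J.filter (cs.IsRightDescent v)).powerset, (-1 : ℚ) ^ K.card =
      if J.filter (cs.IsRightDescent v) = ∅ then 1 else 0 := by exact_mod_cast h4
  simp only [MonoidAlgebra.coeff_single_mul_apply, MonoidAlgebra.coeff_sum,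
    Finsupp.finsetSum_apply, MonoidAlgebra.coeff_smul, Finsupp.smul_apply, coeff_cosetSum, h1,
    inv_mul_cancel_left, smul_eq_mul, mul_ite, mul_one, mul_zero]
  rw [← Finset.sum_filter, h3, h5]
  simp only [h2]

/-! ### Filtration by cardinality and the bound for the descent algebra -/

/-- The span of the `x_K` with fewer than `k` elements in `K`. -/
noncomputable def cardSpan (cs : CoxeterSystem M W) (k : ℕ) : Submodule ℚ (MonoidAlgebra ℚ W) :=
  Submodule.span ℚ (cs.cosetSum '' {K | K.card < k})

theorem cosetSum_mem_cardSpan {K : Finset B} {k : ℕ} (h : K.card < k) :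
    cs.cosetSum K ∈ cs.cardSpan k :=
  Submodule.subset_span ⟨K, h, rfl⟩

theorem cardSpan_mono {k l : ℕ} (h : k ≤ l) : cs.cardSpan k ≤ cs.cardSpan l :=
  Submodule.span_mono (Set.image_mono fun _ hK => lt_of_lt_of_le hK h)

theorem cardSpan_zero : cs.cardSpan 0 = ⊥ := by
  simp [cardSpan]

theorem cosetSum_mem_descentSpan (K : Finset B) : cs.cosetSum K ∈ cs.descentSpan :=
  Submodule.subset_span ⟨K, rfl⟩

theorem cosetSum_univ [Fintype B] : cs.cosetSum Finset.univ = 1 := by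
  classical
  ext w
  rw [coeff_cosetSum, MonoidAlgebra.one_def, MonoidAlgebra.coeff_single, Finsupp.single_apply]
  refine if_congr ?_ rfl rfl
  rw [mem_cosetReps_iff]
  constructor
  · intro h
    by_contra hne
    obtain ⟨i, hi⟩ := cs.exists_rightDescent_of_ne_one (Ne.symm hne)
    exact h i (Finset.mem_univ i) hi
  · rintro rfl i -
    exact cs.not_isRightDescent_one i

theorem cosetSum_mul_cosetSum_mem (I J : Finset B) :
    cs.cosetSum I * cs.cosetSum J ∈ cs.descentSpan := by
  rw [cosetSum_mul_cosetSum]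
  exact sum_mem fun d _ => cosetSum_mem_descentSpan _

/-- Solomon's theorem. -/
theorem toSubmodule_descentAlgebra [Fintype B] (cs : CoxeterSystem M W) :
    Subalgebra.toSubmodule cs.descentAlgebra = cs.descentSpan := by
  refine le_antisymm ?_ (Submodule.span_le.2 Algebra.subset_adjoin)
  let A : Subalgebra ℚ (MonoidAlgebra ℚ W) := cs.descentSpan.toSubalgebra
    (by rw [← cosetSum_univ (cs := cs)]; exact cosetSum_mem_descentSpan _) <| by
      intro x y hx hy
      have := Submodule.mul_mem_mul hx hy
      rw [descentSpan, Submodule.span_mul_span] at this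
      refine Submodule.span_le.2 ?_ this
      rintro _ ⟨_, ⟨I, rfl⟩, _, ⟨J, rfl⟩, rfl⟩
      exact cosetSum_mul_cosetSum_mem I J
  exact (Algebra.adjoin_le (S := A) Submodule.subset_span : cs.descentAlgebra ≤ A)

theorem exists_mul_cosetSum_sub_mem {a : MonoidAlgebra ℚ W} (ha : a ∈ cs.descentSpan)
    (J : Finset B) : ∃ c : ℚ, a * cs.cosetSum J - c • cs.cosetSum J ∈ cs.cardSpan J.card := by
  classical
  induction ha using Submodule.span_induction with
  | mem x hx =>
    obtain ⟨I, rfl⟩ := hx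
    rw [cosetSum_mul_cosetSum,
      ← Finset.sum_filter_add_sum_filter_not _ (fun d => cs.conjInter I J d = J)]
    refine ⟨((Finset.univ.filter (cs.IsDoubleCosetRep I J)).filter
      fun d => cs.conjInter I J d = J).card, ?_⟩
    rw [Finset.sum_congr rfl fun d hd => by rw [(Finset.mem_filter.1 hd).2], Finset.sum_const,
      Nat.cast_smul_eq_nsmul, add_sub_cancel_left]
    refine sum_mem fun d hd => cosetSum_mem_cardSpan (Finset.card_lt_card ?_)
    exact (Finset.filter_subset _ _).ssubset_of_ne (Finset.mem_filter.1 hd).2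
  | zero => exact ⟨0, by simp⟩
  | add x y _ _ hx hy =>
    obtain ⟨c, hc⟩ := hx
    obtain ⟨d, hd⟩ := hy
    refine ⟨c + d, ?_⟩
    have := add_mem hc hd
    rwa [← add_sub_add_comm, ← add_mul, ← add_smul] at this
  | smul r x _ hx =>
    obtain ⟨c, hc⟩ := hx
    refine ⟨r * c, ?_⟩
    have := Submodule.smul_mem _ r hc
    rwa [smul_sub, ← smul_mul_assoc, smul_smul] at this

theorem mul_mem_cardSpan {a v : MonoidAlgebra ℚ W} (ha : a ∈ cs.descentSpan) {k : ℕ}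
    (hv : v ∈ cs.cardSpan k) : a * v ∈ cs.cardSpan k := by
  induction hv using Submodule.span_induction with
  | mem x hx =>
    obtain ⟨K, hK, rfl⟩ := hx
    obtain ⟨c, hc⟩ := exists_mul_cosetSum_sub_mem ha K
    rw [← sub_add_cancel (a * cs.cosetSum K) (c • cs.cosetSum K)]
    exact add_mem (cardSpan_mono (le_of_lt hK) hc)
      (Submodule.smul_mem _ _ (cosetSum_mem_cardSpan hK))
  | zero => simp
  | add x y _ _ hx hy => rw [mul_add]; exact add_mem hx hy
  | smul r x _ hx => rw [mul_smul_comm]; exact Submodule.smul_mem _ _ hx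

theorem mul_mem_cardSpan_of_isNilpotent {a v : MonoidAlgebra ℚ W} (ha : a ∈ cs.descentSpan)
    (hn : IsNilpotent a) {k : ℕ} (hv : v ∈ cs.cardSpan (k + 1)) : a * v ∈ cs.cardSpan k := by
  induction hv using Submodule.span_induction with
  | mem x hx =>
    obtain ⟨K, hK, rfl⟩ := hx
    refine cardSpan_mono (Nat.lt_succ_iff.1 hK) ?_
    obtain ⟨c, hc⟩ := exists_mul_cosetSum_sub_mem ha K
    have hpow (m : ℕ) : a ^ m * cs.cosetSum K - c ^ m • cs.cosetSum K ∈ cs.cardSpan K.card := by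
      induction m with
      | zero => simp
      | succ m ih =>
        have := add_mem (mul_mem_cardSpan ha ih) (Submodule.smul_mem _ (c ^ m) hc)
        rwa [mul_sub, smul_sub, mul_smul_comm, sub_add_sub_cancel, ← mul_assoc, ← pow_succ',
          smul_smul, ← pow_succ] at this
    obtain ⟨N, hN⟩ := hn
    have h := hpow N
    rw [hN, zero_mul, zero_sub, Submodule.neg_mem_iff] at h
    rw [← sub_add_cancel (a * cs.cosetSum K) (c • cs.cosetSum K)]
    refine add_mem hc ?_
    -- Linear independence of the `x_K` is not needed: if `c ≠ 0`, then `c ^ N • x_K` in the lower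
    -- layer puts `x_K` itself there.
    rcases eq_or_ne c 0 with rfl | hc0
    · simp
    · exact Submodule.smul_mem _ _
        ((Submodule.smul_mem_iff _ (pow_ne_zero N hc0)).1 h)
  | zero => simp
  | add x y _ _ hx hy => rw [mul_add]; exact add_mem hx hy
  | smul r x _ hx => rw [mul_smul_comm]; exact Submodule.smul_mem _ _ hx

theorem cosetSum_empty_mul_self :
    cs.cosetSum ∅ * cs.cosetSum ∅ = (Fintype.card W : ℚ) • cs.cosetSum ∅ := by
  classical
  have (w : W) : MonoidAlgebra.single w (1 : ℚ) * cs.cosetSum ∅ = cs.cosetSum ∅ := by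
    ext v
    simp [coeff_cosetSum, mem_cosetReps_iff]
  conv_lhs => enter [1]; rw [cosetSum]
  rw [Finset.sum_mul, Finset.sum_congr rfl fun w _ => this w, Finset.sum_const,
    Nat.cast_smul_eq_nsmul]
  congr 1
  simp [mem_cosetReps_iff]

theorem eq_zero_of_isNilpotent_of_mem_cardSpan_one {a : MonoidAlgebra ℚ W} (hn : IsNilpotent a)
    (ha : a ∈ cs.cardSpan 1) : a = 0 := by
  have : a ∈ Submodule.span ℚ {cs.cosetSum ∅} := by
    simpa [cardSpan, Nat.lt_one_iff, Finset.card_eq_zero] using ha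
  obtain ⟨c, rfl⟩ := Submodule.mem_span_singleton.1 this
  have hpow (m : ℕ) : (c • cs.cosetSum ∅) ^ (m + 1) =
      (c * (c * Fintype.card W) ^ m) • cs.cosetSum ∅ := by
    induction m with
    | zero => simp
    | succ m ih =>
      rw [pow_succ, ih, smul_mul_smul_comm, cosetSum_empty_mul_self, smul_smul]
      congr 1
      ring
  obtain ⟨N, hN⟩ := hn
  have h := hpow N
  rw [pow_succ, hN, zero_mul, eq_comm, smul_eq_zero] at h
  rcases h with h | h
  · have hW : (Fintype.card W : ℚ) ≠ 0 := Nat.cast_ne_zero.2 Fintype.card_ne_zero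
    rcases mul_eq_zero.1 h with h | h
    · simp [h]
    · have := eq_zero_of_pow_eq_zero h
      simp_all
  · simp [h]

theorem isNilpotent_coe_of_mem_jacobson {A : Subalgebra ℚ (MonoidAlgebra ℚ W)} {a : A}
    (ha : a ∈ Ring.jacobson A) : IsNilpotent (a : MonoidAlgebra ℚ W) := by
  have : IsArtinianRing A := IsArtinianRing.of_finite ℚ _
  exact (Ring.isNilpotent_of_mem_jacobson ha).map A.val

/-- Saves the last step of the filtration: for `m ≥ 1` these elements lie in the radical, hence are
nilpotent, and the bottom layer has no nonzero nilpotent. -/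
theorem loewyLength_le_of_mem_cardSpan_one {A : Subalgebra ℚ (MonoidAlgebra ℚ W)} {m : ℕ}
    (hm : 1 ≤ m) (h : ∀ r ∈ Ring.jacobson A ^ m, (r : MonoidAlgebra ℚ W) ∈ cs.cardSpan 1) :
    loewyLength A ≤ m := by
  refine Nat.sInf_le ⟨hm, (Submodule.eq_bot_iff _).2 fun r hr => Subtype.ext ?_⟩
  exact eq_zero_of_isNilpotent_of_mem_cardSpan_one
    (isNilpotent_coe_of_mem_jacobson (Ideal.pow_le_self (by omega) hr)) (h r hr)

theorem coe_mem_descentSpan [Fintype B] {a : MonoidAlgebra ℚ W} (ha : a ∈ cs.descentAlgebra) :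
    a ∈ cs.descentSpan := by
  rwa [← toSubmodule_descentAlgebra, Subalgebra.mem_toSubmodule]

theorem one_mem_cardSpan [Fintype B] : (1 : MonoidAlgebra ℚ W) ∈ cs.cardSpan (Fintype.card B + 1) :=
  cosetSum_univ (cs := cs) ▸ cosetSum_mem_cardSpan (Nat.lt_succ_self _)

theorem loewyLength_descentAlgebra_le [Fintype B] [Nonempty B] :
    loewyLength cs.descentAlgebra ≤ Fintype.card B := by
  refine loewyLength_le_of_mem_cardSpan_one (cs := cs) Fintype.card_pos fun r hr => ?_
  have := Ring.mul_mem_of_mem_jacobson_pow 1 cs.cardSpan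
    (fun a ha k v hv => mul_mem_cardSpan (coe_mem_descentSpan ha) hv) (fun a ha k v hv => ?_)
    hr one_mem_cardSpan
  · simpa using this
  · rcases k with _ | k
    · exact mul_mem_cardSpan (coe_mem_descentSpan a.2) hv
    · exact mul_mem_cardSpan_of_isNilpotent (coe_mem_descentSpan a.2)
        (isNilpotent_coe_of_mem_jacobson ha) hv

/-! ### The fixed subalgebra and the eigenspaces of the longest element -/

theorem single_mul_eq_mul_single_of_mem_fixedDescentAlgebra {w₀ : W} {a : MonoidAlgebra ℚ W}
    (ha : a ∈ cs.fixedDescentAlgebra (MulAut.conj w₀)) :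
    MonoidAlgebra.single w₀ 1 * a = a * MonoidAlgebra.single w₀ 1 := by
  have h : MonoidAlgebra.mapDomainAlgHom ℚ ℚ ((MulAut.conj w₀ : W ≃* W) : W →* W) a = a := by
    simpa using (AlgHom.mem_equalizer _ _ _).1 ha.2
  have key (b : MonoidAlgebra ℚ W) : MonoidAlgebra.single w₀ 1 * b =
      MonoidAlgebra.mapDomainAlgHom ℚ ℚ ((MulAut.conj w₀ : W ≃* W) : W →* W) b *
        MonoidAlgebra.single w₀ 1 := by
    induction b using MonoidAlgebra.induction_linear with
    | zero => simp
    | add x y hx hy => rw [mul_add, map_add, add_mul, hx, hy]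
    | single w c => simp [MonoidAlgebra.single_mul_single]
  rw [key a, h]

theorem IsLongest.single_mul_sub_mem_cardSpan {w₀ : W} (hw₀ : cs.IsLongest w₀) {k : ℕ}
    {v : MonoidAlgebra ℚ W} (hv : v ∈ cs.cardSpan (k + 1)) :
    MonoidAlgebra.single w₀ 1 * v - (-1 : ℚ) ^ k • v ∈ cs.cardSpan k := by
  classical
  induction hv using Submodule.span_induction with
  | mem x hx =>
    obtain ⟨K, hK, rfl⟩ := hx
    have hmem : MonoidAlgebra.single w₀ 1 * cs.cosetSum K - (-1 : ℚ) ^ K.card • cs.cosetSum K ∈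
        cs.cardSpan K.card := by
      rw [hw₀.single_mul_cosetSum, 
        ← Finset.add_sum_erase _ _ (Finset.mem_powerset_self K), add_sub_cancel_left]
      refine sum_mem fun L hL => Submodule.smul_mem _ _
        (cosetSum_mem_cardSpan (Finset.card_lt_card ?_))
      exact (Finset.mem_powerset.1 (Finset.mem_of_mem_erase hL)).ssubset_of_ne
        (Finset.ne_of_mem_erase hL)
    rcases (Nat.lt_succ_iff.1 hK).eq_or_lt with h | h
    · rwa [h] at hmem
    · rw [← sub_add_sub_cancel _ ((-1 : ℚ) ^ K.card • cs.cosetSum K)]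
      refine add_mem (cardSpan_mono h.le hmem) (sub_mem ?_ ?_) <;>
        exact Submodule.smul_mem _ _ (cosetSum_mem_cardSpan h)
  | zero => simp
  | add x y _ _ hx hy =>
    rw [mul_add, smul_add, add_sub_add_comm]
    exact add_mem hx hy
  | smul r x _ hx =>
    rw [mul_smul_comm, smul_comm, ← smul_sub]
    exact Submodule.smul_mem _ _ hx

/-- The eigenvectors of `w₀` in `cardSpan k`, for the sign with which `w₀` acts modulo
`cardSpan (k - 1)`. -/
noncomputable def signedCardSpan (cs : CoxeterSystem M W) (w₀ : W) (k : ℕ) :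
    Submodule ℚ (MonoidAlgebra ℚ W) :=
  cs.cardSpan k ⊓ LinearMap.eqLocus (LinearMap.mulLeft ℚ (MonoidAlgebra.single w₀ 1))
    ((-1 : ℚ) ^ (k + 1) • LinearMap.id)

theorem mem_signedCardSpan {w₀ : W} {k : ℕ} {v : MonoidAlgebra ℚ W} :
    v ∈ cs.signedCardSpan w₀ k ↔
      v ∈ cs.cardSpan k ∧ MonoidAlgebra.single w₀ 1 * v = (-1 : ℚ) ^ (k + 1) • v := Iff.rfl

theorem signedCardSpan_stable [Fintype B] {w₀ : W} {a : MonoidAlgebra ℚ W}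
    (ha : a ∈ cs.fixedDescentAlgebra (MulAut.conj w₀)) {k : ℕ} {v : MonoidAlgebra ℚ W}
    (hv : v ∈ cs.signedCardSpan w₀ k) : a * v ∈ cs.signedCardSpan w₀ k := by
  refine mem_signedCardSpan.2 ⟨mul_mem_cardSpan (coe_mem_descentSpan ha.1) hv.1, ?_⟩
  rw [← mul_assoc, single_mul_eq_mul_single_of_mem_fixedDescentAlgebra ha, mul_assoc,
    (mem_signedCardSpan.1 hv).2, mul_smul_comm]

theorem IsLongest.mul_mem_signedCardSpan_of_isNilpotent [Fintype B] {w₀ : W}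
    (hw₀ : cs.IsLongest w₀) {a : MonoidAlgebra ℚ W}
    (ha : a ∈ cs.fixedDescentAlgebra (MulAut.conj w₀)) (hn : IsNilpotent a) {k : ℕ}
    {v : MonoidAlgebra ℚ W} (hv : v ∈ cs.signedCardSpan w₀ k) :
    a * v ∈ cs.signedCardSpan w₀ (k - 2) := by
  have ha' := coe_mem_descentSpan ha.1
  have hs := (mem_signedCardSpan.1 (signedCardSpan_stable ha hv)).2
  rcases k with _ | _ | k
  · simpa using signedCardSpan_stable ha hv
  · have h := mul_mem_cardSpan_of_isNilpotent ha' hn (mem_signedCardSpan.1 hv).1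
    rw [cardSpan_zero, Submodule.mem_bot] at h
    rw [h]
    exact zero_mem _
  · have h := mul_mem_cardSpan_of_isNilpotent ha' hn (mem_signedCardSpan.1 hv).1
    have h2 := hw₀.single_mul_sub_mem_cardSpan h
    -- The eigenvalue of `a * v` is opposite to the sign of `w₀` on the layer it has reached, so a
    -- nonzero multiple of `a * v` lies one layer lower.
    have e : (-1 : ℚ) ^ (k + 1 + 1 + 1) • (a * v) - (-1 : ℚ) ^ k • (a * v) =
        ((-1 : ℚ) ^ k * (-2)) • (a * v) := by
      rw [← sub_smul]
      congr 1
      ring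
    rw [hs, e, Submodule.smul_mem_iff _ (by simp)] at h2
    refine mem_signedCardSpan.2 ⟨h2, ?_⟩
    rw [hs]
    congr 1
    rw [show k + 1 + 1 - 2 = k from rfl]
    ring

theorem IsLongest.loewyLength_fixedDescentAlgebra_le [Fintype B] [Nonempty B] {w₀ : W}
    (hw₀ : cs.IsLongest w₀) :
    loewyLength (cs.fixedDescentAlgebra (MulAut.conj w₀)) ≤ (Fintype.card B + 1) / 2 := by
  set n := Fintype.card B with hn
  have hpos : 0 < n := Fintype.card_pos
  set x : MonoidAlgebra ℚ W := MonoidAlgebra.single w₀ 1 with hx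
  have hxx : x * x = 1 := by
    rw [hx, MonoidAlgebra.single_mul_single, hw₀.mul_self, one_mul, MonoidAlgebra.one_def]
  have hsq : (-1 : ℚ) ^ n * (-1) ^ n = 1 := by rw [← mul_pow]; simp
  have hmem := hw₀.single_mul_sub_mem_cardSpan (one_mem_cardSpan (cs := cs))
  rw [← hx, ← hn, mul_one] at hmem
  -- The difference of `hplus` and `hneg` is `2 * (-1) ^ n` times `1`. The summand with the wrong
  -- sign for the top layer already lies one layer lower.
  have hneg : x - (-1 : ℚ) ^ n • (1 : MonoidAlgebra ℚ W) ∈ cs.signedCardSpan w₀ n := by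
    refine mem_signedCardSpan.2 ⟨hmem, ?_⟩
    rw [← hx, mul_sub, hxx, mul_smul_comm, mul_one, smul_sub, smul_smul, pow_succ, mul_neg_one,
      neg_mul, hsq]
    module
  have hplus : x + (-1 : ℚ) ^ n • (1 : MonoidAlgebra ℚ W) ∈ cs.signedCardSpan w₀ (n + 1) := by
    refine mem_signedCardSpan.2 ⟨?_, ?_⟩
    · have := add_mem (cardSpan_mono (Nat.le_succ n) hmem)
        (Submodule.smul_mem _ (2 * (-1 : ℚ) ^ n) (one_mem_cardSpan (cs := cs)))
      convert! this using 1
      module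
    · rw [← hx, mul_add, hxx, mul_smul_comm, mul_one, smul_add, smul_smul, pow_succ, pow_succ,
        mul_neg_one, mul_neg_one, neg_neg, hsq]
      module
  refine loewyLength_le_of_mem_cardSpan_one (cs := cs) (by omega) fun r hr => ?_
  have key {k : ℕ} (hk : k ≤ n + 1) {v : MonoidAlgebra ℚ W} (hv : v ∈ cs.signedCardSpan w₀ k) :
      (r : MonoidAlgebra ℚ W) * v ∈ cs.cardSpan 1 := by
    have := Ring.mul_mem_of_mem_jacobson_pow 2 (cs.signedCardSpan w₀)
      (fun a ha k v hv => signedCardSpan_stable ha hv)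
      (fun a ha k v hv => hw₀.mul_mem_signedCardSpan_of_isNilpotent a.2
        (isNilpotent_coe_of_mem_jacobson ha) hv) hr hv
    -- With `m = (n + 1) / 2` rounded down, `n + 1 - 2 * m` is still at most 1.
    exact cardSpan_mono (by omega) (mem_signedCardSpan.1 this).1
  have h := sub_mem (key le_rfl hplus) (key (Nat.le_succ n) hneg)
  rw [← mul_sub, add_sub_sub_cancel, ← two_smul ℚ, smul_smul, mul_smul_comm, mul_one,
    Submodule.smul_mem_iff _ (by simp)] at h
  exact h

end CoxeterSystem

theorem mainTheorem8 {B W : Type*} [Fintype B] [Nonempty B] [Group W] [Fintype W]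
    {M : CoxeterMatrix B} (cs : CoxeterSystem M W) (w₀ : W) (hw₀ : cs.IsLongest w₀) :
    Subalgebra.toSubmodule cs.descentAlgebra = cs.descentSpan ∧
    loewyLength cs.descentAlgebra ≤ Fintype.card B ∧
    (loewyLength (cs.fixedDescentAlgebra (MulAut.conj w₀)) : ℚ) ≤
      ((Fintype.card B : ℚ) + 1) / 2 := by
  refine ⟨CoxeterSystem.toSubmodule_descentAlgebra cs,
    CoxeterSystem.loewyLength_descentAlgebra_le, ?_⟩
  refine (Nat.cast_le.2 hw₀.loewyLength_fixedDescentAlgebra_le).trans ?_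
  simpa using Nat.cast_div_le (α := ℚ) (m := Fintype.card B + 1) (n := 2)
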